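/- Corollary (Ellipses). Consider the Gaussian sequence model $Y_i=\mu_i+\xi_i$, $i=1,\dots,n$, $n\ge 1$, where $\xi_1,\dots,\xi_n$ are i.i.d. $N(0,\sigma^2)$ with $\sigma\ge 0$, and where $\mu$ is an unknown point of the ellipse $$K=\Big\{x\in\mathbb{R}^n:\ \sum_{i=1}^n \frac{x_i^2}{a_i}\le 1\Big\},\qquad 0<a_1\le a_2\le\dots\le a_n .$$ Put $a_0=0$, let $d=\operatorname{diam}(K)$ be the Euclidean diameter of $K$, and let $$R(\sigma,K)=\inf_{\hat\nu}\ \sup_{\mu\in K}\ \mathbb{E}\,\|\hat\nu(Y)-\mu\|^2$$ be the minimax risk, where the infimum is over all measurable functions $\hat\nu:\mathbb{R}^n\to\mathbb{R}^n$ and $\|\cdot\|$ is the Euclidean norm. There are absolute constants $c,C>0$ (independent of $n$, $\sigma$ and $a_1,\dots,a_n$) such that the following holds. 1. If $a_n>\sigma^2$, there is exactly one $k\in\{1,\dots,n\}$ such that $a_{n-k}\le (k+1)\sigma^2$ and $a_{n-k+1}>k\sigma^2$. 2. For every $k\in\{1,\dots,n\}$ with $a_{n-k}\le (k+1)\sigma^2$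 and $a_{n-k+1}>k\sigma^2$, $$c\,\min\{(k+1)\sigma^2,\,d^2\}\ \le\ R(\sigma,K)\ \le\ C\,\min\{(k+1)\sigma^2,\,d^2\}.$$ 3. If $a_n\le\sigma^2$, then $c\,d^2\le R(\sigma,K)\le C\,d^2$. -/

import Mathlib

open MeasureTheory ProbabilityTheory
open scoped ENNReal NNReal

/-- The law `N(0, σ² I)` on `ℝⁿ`: independent `N(0, σ²)` coordinates. -/
noncomputable def gaussianNoise (n : ℕ) (σ : ℝ) : Measure (EuclideanSpace ℝ (Fin n)) :=
  (Measure.pi fun _ : Fin n => gaussianReal 0 (Real.toNNReal (σ ^ 2))).map (WithLp.toLp 2)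

/-- The risk `𝔼 ‖ν(Y) - μ‖²` of the estimator `ν` at the parameter `μ`, where `Y = μ + ξ` with
`ξ ∼ N(0, σ² I)`; it may be `∞`. -/
noncomputable def quadraticRisk {n : ℕ} (σ : ℝ)
    (ν : EuclideanSpace ℝ (Fin n) → EuclideanSpace ℝ (Fin n))
    (μ : EuclideanSpace ℝ (Fin n)) : ℝ≥0∞ :=
  ∫⁻ ξ, ENNReal.ofReal (‖ν (μ + ξ) - μ‖ ^ 2) ∂(gaussianNoise n σ)

/-- The minimax risk `inf_ν sup_{μ ∈ K} 𝔼 ‖ν(Y) - μ‖²`, the infimum being over all measurable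
functions `ν` of the data. -/
noncomputable def gaussianMinimaxRisk {n : ℕ} (σ : ℝ) (K : Set (EuclideanSpace ℝ (Fin n))) : ℝ≥0∞ :=
  ⨅ (ν : EuclideanSpace ℝ (Fin n) → EuclideanSpace ℝ (Fin n)) (_ : Measurable ν),
    ⨆ μ ∈ K, quadraticRisk σ ν μ

/-- The ellipse `{x : ∑ i, x i ^ 2 / a i ≤ 1}`. -/
def ellipse {n : ℕ} (a : Fin n → ℝ) : Set (EuclideanSpace ℝ (Fin n)) :=
  {x | ∑ i, x i ^ 2 / a i ≤ 1}

/-- The numbering `a₁, …, aₙ` of the entries of a tuple, with the convention `a₀ = 0`.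
(Indices beyond `n` are never used.) -/
def oneIndexed {n : ℕ} (a : Fin n → ℝ) : ℕ → ℝ
  | 0 => 0
  | j + 1 => if h : j < n then a ⟨j, h⟩ else 0

/-- The conditions `k ∈ {1, …, n}`, `a_{n-k} ≤ (k+1) σ²` and `a_{n-k+1} > k σ²`. -/
def IsCriticalIndex {n : ℕ} (a : Fin n → ℝ) (σ : ℝ) (k : ℕ) : Prop :=
  1 ≤ k ∧ k ≤ n ∧ oneIndexed a (n - k) ≤ ((k : ℝ) + 1) * σ ^ 2 ∧
    (k : ℝ) * σ ^ 2 < oneIndexed a (n - k + 1)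

/-! Upper bound: keep the `k` coordinates with the longest axes and estimate the rest by zero. The
variance is `k σ²` and the squared bias is at most `a_{n-k} ≤ (k+1) σ²`; estimating everything by
zero costs at most `a_n = d²/4` (`gaussianMinimaxRisk_ellipse_le`, `diam_ellipse_sq`).

Lower bound: since `a_{n-k+1} > k σ²`, the ellipse contains the cube with vertices `±σ` on those
same `k` axes. Assouad's lemma (`gaussianMinimaxRisk_ge_of_box`) gives a constant times `σ²` per
axis, because noise of size `σ` hides each sign. If `a_n ≤ σ²`, the endpoints of the longest axis
already give order `a_n`. -/

/-! ### Two-point bound in dimension one -/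

/-- The constant in the two-point bound `lintegral_sq_sub_add_lintegral_sq_add_ge`. -/
noncomputable def twoPointConst : ℝ := 4 * Real.exp (-2) / √(2 * Real.pi)

theorem twoPointConst_pos : 0 < twoPointConst := by unfold twoPointConst; positivity

/-- Here `|x - δ| ≤ 2σ`, so the exponent is at least `-(2σ)²/(2σ²) = -2`. -/
theorem gaussianPDFReal_ge_of_abs_le {σ δ x : ℝ} (hσ : 0 < σ) (hδ : |δ| ≤ σ) (hx : |x| ≤ σ) :
    Real.exp (-2) / (√(2 * Real.pi) * σ) ≤ gaussianPDFReal δ (σ ^ 2).toNNReal x := by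
  have hv : (((σ ^ 2).toNNReal : ℝ≥0) : ℝ) = σ ^ 2 := Real.coe_toNNReal _ (sq_nonneg σ)
  rw [gaussianPDFReal, hv, Real.sqrt_mul (by positivity) (σ ^ 2), Real.sqrt_sq hσ.le,
    div_eq_inv_mul]
  gcongr
  have h : |x - δ| ≤ |2 * σ| := by
    rw [abs_of_pos (by positivity : 0 < 2 * σ)]
    linarith [abs_sub x δ]
  rw [neg_div, neg_le_neg_iff, div_le_iff₀ (by positivity)]
  nlinarith [sq_le_sq.mpr h]

theorem lintegral_gaussianReal_const_add {g : ℝ → ℝ≥0∞} (hg : Measurable g) (δ : ℝ) (v : ℝ≥0) :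
    ∫⁻ t, g (δ + t) ∂gaussianReal 0 v = ∫⁻ t, g t ∂gaussianReal δ v := by
  rw [← zero_add δ, ← gaussianReal_map_const_add δ, zero_add, lintegral_map hg (by fun_prop)]

/-- The minorant does not depend on `δ`, so the laws with means `δ` and `-δ` can be compared on one
common measure. -/
theorem lintegral_gaussianReal_ge {σ δ : ℝ} (hσ : 0 < σ) (hδ : |δ| ≤ σ) {g : ℝ → ℝ≥0∞}
    (hg : Measurable g) :
    ENNReal.ofReal (Real.exp (-2) / (√(2 * Real.pi) * σ)) * ∫⁻ x in Set.Icc (-σ) σ, g x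
      ≤ ∫⁻ x, g x ∂gaussianReal δ (σ ^ 2).toNNReal := by
  have hv : (σ ^ 2).toNNReal ≠ 0 := by
    rw [ne_eq, Real.toNNReal_eq_zero, not_le]; positivity
  rw [gaussianReal_of_var_ne_zero _ hv,
    lintegral_withDensity_eq_lintegral_mul _ (measurable_gaussianPDF _ _) hg,
    ← lintegral_const_mul _ hg]
  refine le_trans ?_ (setLIntegral_le_lintegral (Set.Icc (-σ) σ) _)
  refine setLIntegral_mono ((measurable_gaussianPDF _ _).mul hg) fun x hx => ?_
  rw [Pi.mul_apply, gaussianPDF]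
  gcongr
  exact gaussianPDFReal_ge_of_abs_le hσ hδ (abs_le.mpr hx)

/-- Two-point lower bound for a single Gaussian observation with mean `δ` or `-δ`. -/
theorem lintegral_sq_sub_add_lintegral_sq_add_ge {σ δ : ℝ} (hσ : 0 < σ) (hδ : |δ| ≤ σ)
    {h : ℝ → ℝ} (hh : Measurable h) :
    ENNReal.ofReal (twoPointConst * δ ^ 2) ≤
      ∫⁻ t, ENNReal.ofReal ((h (δ + t) - δ) ^ 2) ∂gaussianReal 0 (σ ^ 2).toNNReal +
      ∫⁻ t, ENNReal.ofReal ((h (-δ + t) + δ) ^ 2) ∂gaussianReal 0 (σ ^ 2).toNNReal := by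
  have h₁ : Measurable fun s => ENNReal.ofReal ((h s - δ) ^ 2) := by fun_prop
  have h₂ : Measurable fun s => ENNReal.ofReal ((h s + δ) ^ 2) := by fun_prop
  rw [lintegral_gaussianReal_const_add h₁, lintegral_gaussianReal_const_add h₂]
  refine le_trans ?_ (add_le_add (lintegral_gaussianReal_ge hσ hδ h₁)
    (lintegral_gaussianReal_ge hσ (by rwa [abs_neg]) h₂))
  rw [← mul_add, ← lintegral_add_left h₁]
  -- Pointwise, `(h - δ)² + (h + δ)² = 2h² + 2δ² ≥ 2δ²`, integrated over an interval of length `2σ`.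
  have hc : ENNReal.ofReal (2 * δ ^ 2) * ENNReal.ofReal (2 * σ) ≤
      ∫⁻ x in Set.Icc (-σ) σ,
        (ENNReal.ofReal ((h x - δ) ^ 2) + ENNReal.ofReal ((h x + δ) ^ 2)) := by
    calc _ = ∫⁻ _ in Set.Icc (-σ) σ, ENNReal.ofReal (2 * δ ^ 2) := by
          rw [setLIntegral_const, Real.volume_Icc]; ring_nf
      _ ≤ _ := by
          refine lintegral_mono fun x => ?_
          rw [← ENNReal.ofReal_add (sq_nonneg _) (sq_nonneg _)]
          exact ENNReal.ofReal_le_ofReal (by nlinarith [sq_nonneg (h x)])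
  refine le_trans (le_of_eq ?_) (mul_le_mul_right hc _)
  rw [← ENNReal.ofReal_mul (by positivity), ← ENNReal.ofReal_mul (by positivity), twoPointConst]
  congr 1
  field_simp
  ring

/-! ### Assouad's lemma in the sequence model -/

instance {n : ℕ} {σ : ℝ} : IsProbabilityMeasure (gaussianNoise n σ) :=
  Measure.isProbabilityMeasure_map (WithLp.measurable_toLp 2 _).aemeasurable

theorem lintegral_gaussianNoise {n : ℕ} (σ : ℝ) {f : EuclideanSpace ℝ (Fin n) → ℝ≥0∞}
    (hf : Measurable f) :
    ∫⁻ ξ, f ξ ∂gaussianNoise n σ =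
      ∫⁻ x, f (WithLp.toLp 2 x) ∂Measure.pi fun _ : Fin n => gaussianReal 0 (σ ^ 2).toNNReal :=
  lintegral_map hf (WithLp.measurable_toLp 2 _)

/-- By Tonelli, coordinate `i` is integrated first with the others frozen; a bound uniform in the
frozen values survives averaging. -/
theorem const_le_lintegral_pi {ι : Type*} [Fintype ι] [DecidableEq ι] {X : ι → Type*}
    [∀ i, MeasurableSpace (X i)] (P : ∀ i, Measure (X i)) [∀ i, IsProbabilityMeasure (P i)]
    {f : (∀ i, X i) → ℝ≥0∞} (hf : Measurable f) (i : ι) {c : ℝ≥0∞}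
    (h : ∀ x, c ≤ ∫⁻ t, f (Function.update x i t) ∂P i) : c ≤ ∫⁻ x, f x ∂Measure.pi P := by
  obtain ⟨x⟩ : Nonempty (∀ i, X i) := ⟨fun j => (P j).nonempty_of_neZero.some⟩
  rw [lintegral_eq_lmarginal_univ x, lmarginal_erase' _ hf (Finset.mem_univ i)]
  refine le_trans ?_ (lmarginal_mono (f := fun _ => c) h x)
  simp [lmarginal]

/-- Two-point lower bound for the `i`-th coordinate in the Gaussian sequence model. -/
theorem coordinate_risk_add_ge {n : ℕ} {σ : ℝ} (hσ : 0 < σ)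
    {ν : EuclideanSpace ℝ (Fin n) → EuclideanSpace ℝ (Fin n)} (hν : Measurable ν)
    (i : Fin n) {m m' : EuclideanSpace ℝ (Fin n)} (hne : ∀ j, j ≠ i → m' j = m j)
    (hi : m' i = -m i) (hm : |m i| ≤ σ) :
    ENNReal.ofReal (twoPointConst * m i ^ 2) ≤
      ∫⁻ ξ, ENNReal.ofReal ((ν (m + ξ) i - m i) ^ 2) ∂gaussianNoise n σ +
      ∫⁻ ξ, ENNReal.ofReal ((ν (m' + ξ) i - m' i) ^ 2) ∂gaussianNoise n σ := by
  have hmeas : ∀ p : EuclideanSpace ℝ (Fin n),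
      Measurable fun ξ => ENNReal.ofReal ((ν (p + ξ) i - p i) ^ 2) := fun p => by fun_prop
  rw [← lintegral_add_left (hmeas m)]
  refine le_of_le_of_eq ?_ (lintegral_gaussianNoise σ ((hmeas m).add (hmeas m'))).symm
  refine const_le_lintegral_pi _
    (((hmeas m).add (hmeas m')).comp (WithLp.measurable_toLp 2 _)) i fun x => ?_
  -- `m` and `m'` agree off `i`, so for frozen noise both observations vary along the same line
  -- through `z`, and one function `h` serves both.
  let z : Fin n → ℝ := fun j => m j + x j
  let h : ℝ → ℝ := fun s => ν (WithLp.toLp 2 (Function.update z i s)) i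
  have hh : Measurable h := by
    have : Measurable fun s => Function.update z i s := measurable_update z
    fun_prop
  have e₁ : ∀ t, m + WithLp.toLp 2 (Function.update x i t) =
      WithLp.toLp 2 (Function.update z i (m i + t)) := fun t => by
    ext j
    rcases eq_or_ne j i with rfl | hj <;> simp [z, *]
  have e₂ : ∀ t, m' + WithLp.toLp 2 (Function.update x i t) =
      WithLp.toLp 2 (Function.update z i (-m i + t)) := fun t => by
    ext j
    rcases eq_or_ne j i with rfl | hj <;> simp [z, *]
  refine (lintegral_sq_sub_add_lintegral_sq_add_ge hσ hm hh).trans (le_of_eq ?_)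
  rw [← lintegral_add_left (by fun_prop)]
  simp only [Function.comp_apply, Pi.add_apply, e₁, e₂, hi, sub_neg_eq_add, h]

theorem quadraticRisk_eq_sum {n : ℕ} (σ : ℝ)
    {ν : EuclideanSpace ℝ (Fin n) → EuclideanSpace ℝ (Fin n)} (hν : Measurable ν)
    (m : EuclideanSpace ℝ (Fin n)) :
    quadraticRisk σ ν m =
      ∑ i, ∫⁻ ξ, ENNReal.ofReal ((ν (m + ξ) i - m i) ^ 2) ∂gaussianNoise n σ := by
  rw [quadraticRisk, ← lintegral_finsetSum _ fun i _ => by fun_prop]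
  refine lintegral_congr fun ξ => ?_
  rw [EuclideanSpace.norm_sq_eq, ENNReal.ofReal_sum_of_nonneg fun i _ => by positivity]
  simp

/-- Assouad's lemma for a set containing the vertices `(±θ i)ᵢ` of a box. -/
theorem gaussianMinimaxRisk_ge_of_box {n : ℕ} {σ : ℝ} {K : Set (EuclideanSpace ℝ (Fin n))}
    (hσ : 0 < σ) (θ : Fin n → ℝ) (hθ : ∀ i, |θ i| ≤ σ)
    (hK : ∀ x : EuclideanSpace ℝ (Fin n), (∀ i, x i ^ 2 = θ i ^ 2) → x ∈ K) :
    ENNReal.ofReal (twoPointConst / 2 * ∑ i, θ i ^ 2) ≤ gaussianMinimaxRisk σ K := by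
  refine le_iInf₂ fun ν hν => ?_
  let p : (Fin n → Bool) → EuclideanSpace ℝ (Fin n) := fun ε =>
    WithLp.toLp 2 fun i => if ε i then θ i else -θ i
  have hp : ∀ ε i, p ε i ^ 2 = θ i ^ 2 := fun ε i => by
    by_cases h : ε i <;> simp [p, h]
  let r : Fin n → (Fin n → Bool) → ℝ≥0∞ := fun i ε =>
    ∫⁻ ξ, ENNReal.ofReal ((ν (p ε + ξ) i - p ε i) ^ 2) ∂gaussianNoise n σ
  have hr : ∀ i, (2 : ℝ≥0∞) ^ n * ENNReal.ofReal (twoPointConst * θ i ^ 2) ≤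
      2 * ∑ ε, r i ε := fun i => by
    -- Flipping the `i`-th sign pairs the vertices that differ only there; summing over all vertices
    -- counts each pair twice, hence the factor `2`.
    let e : (Fin n → Bool) ≃ (Fin n → Bool) :=
      Function.Involutive.toPerm (fun ε => Function.update ε i (!ε i)) fun ε => by simp
    have he : ∀ ε, e ε = Function.update ε i (!ε i) := fun _ => rfl
    calc (2 : ℝ≥0∞) ^ n * ENNReal.ofReal (twoPointConst * θ i ^ 2)
        = ∑ ε : Fin n → Bool, ENNReal.ofReal (twoPointConst * p ε i ^ 2) := by simp [hp]
      _ ≤ ∑ ε, (r i ε + r i (e ε)) := by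
          refine Finset.sum_le_sum fun ε _ => coordinate_risk_add_ge hσ hν i ?_ ?_ ?_
          · intro j hj
            simp [p, he, hj]
          · by_cases h : ε i <;> simp [p, he, h]
          · rw [← sq_le_sq₀ (abs_nonneg _) hσ.le, sq_abs, hp, ← sq_abs]
            exact pow_le_pow_left₀ (abs_nonneg _) (hθ i) 2
      _ = 2 * ∑ ε, r i ε := by rw [Finset.sum_add_distrib, Equiv.sum_comp e, two_mul]
  set R := ⨆ m ∈ K, quadraticRisk σ ν m
  -- The supremum dominates the average over the `2 ^ n` vertices.
  have hR : ∑ i, ∑ ε, r i ε ≤ 2 ^ n * R := by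
    rw [Finset.sum_comm]
    calc ∑ ε, ∑ i, r i ε ≤ ∑ _ε : Fin n → Bool, R := Finset.sum_le_sum fun ε _ => by
          rw [← quadraticRisk_eq_sum σ hν]
          exact le_iSup₂ (f := fun m (_ : m ∈ K) => quadraticRisk σ ν m) (p ε) (hK _ (hp ε))
      _ = 2 ^ n * R := by simp
  have h2 : (2 : ℝ≥0∞) ^ n * ENNReal.ofReal (twoPointConst * ∑ i, θ i ^ 2) ≤
      2 ^ n * (2 * R) := by
    have hc := twoPointConst_pos.le
    rw [Finset.mul_sum, ENNReal.ofReal_sum_of_nonneg fun i _ => by positivity, Finset.mul_sum]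
    calc _ ≤ ∑ i, 2 * ∑ ε, r i ε := Finset.sum_le_sum fun i _ => hr i
      _ ≤ 2 * (2 ^ n * R) := by rw [← Finset.mul_sum]; gcongr
      _ = _ := by ring
  rw [ENNReal.mul_le_mul_iff_right (by simp) (by simp)] at h2
  rw [← ENNReal.mul_le_mul_iff_right (a := 2) (by simp) (by simp)]
  refine le_trans (le_of_eq ?_) h2
  rw [← ENNReal.ofReal_ofNat 2, ← ENNReal.ofReal_mul (by norm_num)]
  congr 1
  ring

/-! ### Projection estimators and the diameter -/

theorem lintegral_sq_gaussianReal (v : ℝ≥0) :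
    ∫⁻ t, ENNReal.ofReal (t ^ 2) ∂gaussianReal 0 v = v := by
  have h := (memLp_id_gaussianReal (μ := 0) (v := v) 2).ofReal_variance_eq
  rw [variance_id_gaussianReal, evariance_eq_lintegral_ofReal] at h
  simpa using h.symm

theorem lintegral_coord_sq_gaussianNoise {n : ℕ} (σ : ℝ) (i : Fin n) :
    ∫⁻ ξ, ENNReal.ofReal (ξ i ^ 2) ∂gaussianNoise n σ = ENNReal.ofReal (σ ^ 2) := by
  rw [lintegral_gaussianNoise σ (by fun_prop)]
  exact ((measurePreserving_eval (fun _ : Fin n => gaussianReal 0 (σ ^ 2).toNNReal) i).lintegral_comp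
    (f := fun t => ENNReal.ofReal (t ^ 2)) (by fun_prop)).trans (lintegral_sq_gaussianReal _)

/-- Controls the squared bias from discarding the coordinates in `S`: there `x i ^ 2 ≤ M * (x i ^ 2
/ a i)`. -/
theorem sum_sq_le_of_mem_ellipse {n : ℕ} {a : Fin n → ℝ} (ha : ∀ i, 0 < a i) {M : ℝ} (hM : 0 ≤ M)
    (S : Finset (Fin n)) (hS : ∀ i ∈ S, a i ≤ M) {x : EuclideanSpace ℝ (Fin n)}
    (hx : x ∈ ellipse a) : ∑ i ∈ S, x i ^ 2 ≤ M := by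
  have hx : ∑ i, x i ^ 2 / a i ≤ 1 := hx
  calc ∑ i ∈ S, x i ^ 2 ≤ ∑ i ∈ S, M * (x i ^ 2 / a i) := by
        refine Finset.sum_le_sum fun i hi => ?_
        rw [mul_div_assoc', le_div_iff₀ (ha i), mul_comm]
        gcongr
        exact hS i hi
    _ ≤ M * ∑ i, x i ^ 2 / a i := by
        rw [← Finset.mul_sum]
        gcongr
        · exact fun i _ _ => div_nonneg (sq_nonneg _) (ha i).le
        · exact Finset.subset_univ S
    _ ≤ M := mul_le_of_le_one_right hM hx

/-- The risk of keeping the coordinates in `S` and estimating the others by zero. -/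
theorem gaussianMinimaxRisk_ellipse_le {n : ℕ} {a : Fin n → ℝ} (ha : ∀ i, 0 < a i) (σ : ℝ) {M : ℝ}
    (hM : 0 ≤ M) (S : Finset (Fin n)) (hS : ∀ i ∉ S, a i ≤ M) :
    gaussianMinimaxRisk σ (ellipse a) ≤ ENNReal.ofReal (S.card * σ ^ 2 + M) := by
  let ν : EuclideanSpace ℝ (Fin n) → EuclideanSpace ℝ (Fin n) :=
    fun y => WithLp.toLp 2 fun i => if i ∈ S then y i else 0
  have hν : Measurable ν := by
    refine (WithLp.measurable_toLp 2 _).comp (measurable_pi_lambda _ fun i => ?_)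
    split_ifs <;> fun_prop
  refine iInf₂_le_of_le ν hν (iSup₂_le fun m hm => ?_)
  rw [quadraticRisk_eq_sum σ hν, ← Finset.sum_add_sum_compl S,
    ENNReal.ofReal_add (by positivity) hM]
  refine add_le_add (le_of_eq ?_) ?_
  · rw [ENNReal.ofReal_mul (by positivity), ENNReal.ofReal_natCast, ← nsmul_eq_mul]
    refine Finset.sum_eq_card_nsmul fun i hi => ?_
    simpa [ν, hi] using lintegral_coord_sq_gaussianNoise σ i
  · refine le_trans (le_of_eq ?_) (ENNReal.ofReal_le_ofReal
      (sum_sq_le_of_mem_ellipse ha hM Sᶜ (fun i hi => hS i (by simpa using hi)) hm))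
    rw [ENNReal.ofReal_sum_of_nonneg fun i _ => sq_nonneg _]
    refine Finset.sum_congr rfl fun i hi => ?_
    simp [ν, Finset.mem_compl.mp hi]

/-- The ellipse lies in the ball of radius `√(a l)`, and the points `±√(a l)` on axis `l` attain the
diameter. -/
theorem diam_ellipse_sq {n : ℕ} {a : Fin n → ℝ} (ha : ∀ i, 0 < a i) {l : Fin n}
    (hl : ∀ i, a i ≤ a l) : Metric.diam (ellipse a) ^ 2 = 4 * a l := by
  have hs : √(a l) ^ 2 = a l := Real.sq_sqrt (ha l).le
  have hnorm : ∀ x ∈ ellipse a, ‖x‖ ≤ √(a l) := fun x hx => by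
    rw [EuclideanSpace.norm_eq]
    refine Real.sqrt_le_sqrt ?_
    simpa using sum_sq_le_of_mem_ellipse ha (ha l).le Finset.univ (fun i _ => hl i) hx
  have hdist : ∀ x ∈ ellipse a, ∀ y ∈ ellipse a, dist x y ≤ 2 * √(a l) := fun x hx y hy => by
    rw [dist_eq_norm]
    linarith [norm_sub_le x y, hnorm x hx, hnorm y hy]
  have hmem : ∀ s : ℝ, s ^ 2 = a l → EuclideanSpace.single l s ∈ ellipse a := fun s h => by
    change ∑ i, _ ≤ (1 : ℝ)
    rw [Finset.sum_eq_single l (fun i _ hi => by simp [hi]) (by simp)]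
    simp [h, (ha l).ne']
  have hd : Metric.diam (ellipse a) = 2 * √(a l) := by
    refine le_antisymm (Metric.diam_le_of_forall_dist_le (by positivity) hdist) ?_
    have := Metric.dist_le_diam_of_mem (Metric.isBounded_iff.mpr ⟨_, fun x hx y hy => hdist x hx y hy⟩)
      (hmem _ hs) (hmem (-√(a l)) (by rw [neg_sq, hs]))
    rw [PiLp.dist_single_same, Real.dist_eq, sub_neg_eq_add, ← two_mul,
      abs_of_nonneg (by positivity)] at this
    exact this
  rw [hd, mul_pow, hs]
  norm_num

/-! ### The critical index -/

theorem oneIndexed_succ {n : ℕ} (a : Fin n → ℝ) (i : Fin n) : oneIndexed a (i + 1) = a i := by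
  simp [oneIndexed]

theorem oneIndexed_mono {n : ℕ} {a : Fin n → ℝ} (ha : ∀ i, 0 < a i) (hmono : Monotone a) {i j : ℕ}
    (hij : i ≤ j) (hj : j ≤ n) : oneIndexed a i ≤ oneIndexed a j := by
  cases j with
  | zero => rw [Nat.le_zero.mp hij]
  | succ j =>
    rw [oneIndexed_succ a ⟨j, hj⟩]
    cases i with
    | zero => exact (ha _).le
    | succ i =>
      rw [oneIndexed_succ a ⟨i, by omega⟩]
      exact hmono (Fin.mk_le_mk.mpr (by omega))

/-- As `j` grows, `a_{n-j}` decreases and `(j+1) σ²` increases, so `P` below, once true, stays true.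
The second condition on `k` is `¬ P (k - 1)`, so `k` is the first index where `P` holds. -/
theorem existsUnique_isCriticalIndex {n : ℕ} {a : Fin n → ℝ} (ha : ∀ i, 0 < a i)
    (hmono : Monotone a) {σ : ℝ} (h : σ ^ 2 < oneIndexed a n) :
    ∃! k : ℕ, IsCriticalIndex a σ k := by
  classical
  let P : ℕ → Prop := fun j => oneIndexed a (n - j) ≤ ((j : ℝ) + 1) * σ ^ 2
  -- The convention `a₀ = 0` makes the search end by `n`.
  have hPn : P n := by simp only [P, Nat.sub_self, oneIndexed]; positivity
  have hP0 : ¬ P 0 := by simpa [P] using h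
  have hPmono : ∀ {i j}, i ≤ j → P i → P j := fun {i j} hij hi =>
    (oneIndexed_mono ha hmono (by omega) (by omega)).trans (hi.trans (by gcongr))
  have hcrit : ∀ {k}, 1 ≤ k → k ≤ n → (¬ P (k - 1) ↔ (k : ℝ) * σ ^ 2 < oneIndexed a (n - k + 1)) := by
    intro k hk hkn
    obtain ⟨k, rfl⟩ := Nat.exists_eq_add_of_le' hk
    simp only [P, not_le, Nat.add_sub_cancel, show n - (k + 1) + 1 = n - k by omega, Nat.cast_add,
      Nat.cast_one]
  have hex : ∃ k, P k := ⟨n, hPn⟩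
  have h1 : 1 ≤ Nat.find hex := Nat.one_le_iff_ne_zero.mpr fun h0 => hP0 (h0 ▸ Nat.find_spec hex)
  have hn : Nat.find hex ≤ n := Nat.find_min' hex hPn
  refine ⟨Nat.find hex, ⟨h1, hn, Nat.find_spec hex,
    (hcrit h1 hn).mp (Nat.find_min hex (by omega))⟩, fun k ⟨hk1, hkn, hk, hk'⟩ => ?_⟩
  refine le_antisymm ?_ (Nat.find_min' hex hk)
  by_contra hlt
  exact (hcrit hk1 hkn).mpr hk' (hPmono (by omega) (Nat.find_spec hex))

theorem card_filter_sub_le {n k : ℕ} (hk : k ≤ n) :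
    (Finset.univ.filter fun i : Fin n => n - k ≤ i).card = k := by
  have h := Fin.sum_univ_eq_sum_range (fun i => if n - k ≤ i then 1 else 0) n
  rw [Finset.card_filter, h, ← Finset.card_filter]
  have : (Finset.range n).filter (fun i => n - k ≤ i) = Finset.Ico (n - k) n := by
    ext i
    simp [and_comm]
  rw [this, Nat.card_Ico]
  omega

theorem oneIndexed_last {n : ℕ} {a : Fin n → ℝ} (hn : 1 ≤ n) (hmono : Monotone a) :
    ∃ l, oneIndexed a n = a l ∧ ∀ i, a i ≤ a l := by
  obtain ⟨m, rfl⟩ := Nat.exists_eq_add_of_le' hn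
  exact ⟨Fin.last m, oneIndexed_succ a (Fin.last m), fun i => hmono (Fin.le_last i)⟩

/-! ### Lower bounds for the ellipse and conclusion -/

theorem minimaxRisk_ellipse_ge_of_isCriticalIndex {n : ℕ} {a : Fin n → ℝ} (ha : ∀ i, 0 < a i)
    (hmono : Monotone a) {σ : ℝ} (hσ : 0 ≤ σ) {k : ℕ} (hk : IsCriticalIndex a σ k) :
    ENNReal.ofReal (twoPointConst / 2 * (k * σ ^ 2)) ≤ gaussianMinimaxRisk σ (ellipse a) := by
  obtain ⟨hk1, hkn, -, hk⟩ := hk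
  rcases hσ.eq_or_lt with rfl | hσ
  · simp
  -- Entries of `Fin n` count from zero, so `n - k ≤ i` selects `a_{n-k+1}, …, a_n`.
  let S := Finset.univ.filter fun i : Fin n => n - k ≤ i
  have hS : S.card = k := card_filter_sub_le hkn
  have hsum : ∑ i : Fin n, (if i ∈ S then σ else 0) ^ 2 = k * σ ^ 2 := by
    simp [ite_pow, hS]
  rw [← hsum]
  refine gaussianMinimaxRisk_ge_of_box hσ _ (fun i => ?_) fun x hx => ?_
  · split_ifs <;> simp [abs_of_pos hσ, hσ.le]
  · change ∑ i, _ ≤ (1 : ℝ)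
    have hkpos : (0 : ℝ) < k := by exact_mod_cast hk1
    -- Each of the `k` active axes contributes `σ²/a i ≤ 1/k`.
    calc ∑ i, x i ^ 2 / a i ≤ ∑ i : Fin n, (if i ∈ S then (k : ℝ)⁻¹ else 0) := by
          refine Finset.sum_le_sum fun i _ => ?_
          rw [hx i]
          split_ifs with hi
          · have : (k : ℝ) * σ ^ 2 < a i := hk.trans_le <| by
              rw [← oneIndexed_succ a i]
              exact oneIndexed_mono ha hmono (by simpa [S] using hi) i.2
            rw [div_le_iff₀ (ha i), inv_mul_eq_div, le_div_iff₀ hkpos]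
            linarith
          · simp
      _ = 1 := by simp [hS, hkpos.ne']

theorem minimaxRisk_ellipse_ge_of_le {n : ℕ} {a : Fin n → ℝ} (ha : ∀ i, 0 < a i) {σ : ℝ}
    (hσ : 0 ≤ σ) {l : Fin n} (hl : a l ≤ σ ^ 2) :
    ENNReal.ofReal (twoPointConst / 2 * a l) ≤ gaussianMinimaxRisk σ (ellipse a) := by
  have hσ' : 0 < σ := hσ.lt_of_ne (by rintro rfl; simpa using (ha l).trans_le hl)
  have hs : √(a l) ^ 2 = a l := Real.sq_sqrt (ha l).le
  have hsum : ∑ i, (if i = l then √(a l) else 0) ^ 2 = a l := by simp [ite_pow, hs]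
  nth_rw 1 [← hsum]
  refine gaussianMinimaxRisk_ge_of_box hσ' _ (fun i => ?_) fun x hx => ?_
  · split_ifs
    · rw [abs_of_nonneg (Real.sqrt_nonneg _)]
      exact Real.sqrt_le_iff.mpr ⟨hσ, hl⟩
    · simpa using hσ
  · change ∑ i, _ ≤ (1 : ℝ)
    rw [Finset.sum_eq_single l (fun i _ hi => by simp [hx i, hi]) (by simp)]
    simp [hx, hs, (ha l).ne']

theorem mainTheorem6 :
    ∃ c C : ℝ, 0 < c ∧ 0 < C ∧
      ∀ (n : ℕ) (a : Fin n → ℝ) (σ : ℝ), 1 ≤ n → (∀ i, 0 < a i) → Monotone a → 0 ≤ σ →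
        (σ ^ 2 < oneIndexed a n → ∃! k : ℕ, IsCriticalIndex a σ k) ∧
        (∀ k : ℕ, IsCriticalIndex a σ k →
          ENNReal.ofReal (c * min (((k : ℝ) + 1) * σ ^ 2) (Metric.diam (ellipse a) ^ 2))
              ≤ gaussianMinimaxRisk σ (ellipse a) ∧
          gaussianMinimaxRisk σ (ellipse a) ≤
            ENNReal.ofReal (C * min (((k : ℝ) + 1) * σ ^ 2) (Metric.diam (ellipse a) ^ 2))) ∧
        (oneIndexed a n ≤ σ ^ 2 →
          ENNReal.ofReal (c * Metric.diam (ellipse a) ^ 2) ≤ gaussianMinimaxRisk σ (ellipse a) ∧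
          gaussianMinimaxRisk σ (ellipse a) ≤ ENNReal.ofReal (C * Metric.diam (ellipse a) ^ 2)) := by
  have hc := twoPointConst_pos
  -- The `8` combines Assouad's factor `1/2` with `d² = 4 a_n`; it also covers `k + 1 ≤ 4k`. The `2`
  -- comes from `k σ² + (k+1) σ² ≤ 2 (k+1) σ²`.
  refine ⟨twoPointConst / 8, 2, by positivity, by norm_num, fun n a σ hn ha hmono hσ => ?_⟩
  obtain ⟨l, hl, hmax⟩ := oneIndexed_last hn hmono
  have hdiam := diam_ellipse_sq ha hmax
  have hal := ha l
  have hzero : gaussianMinimaxRisk σ (ellipse a) ≤ ENNReal.ofReal (a l) := by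
    simpa using gaussianMinimaxRisk_ellipse_le ha σ hal.le ∅ fun i _ => hmax i
  refine ⟨existsUnique_isCriticalIndex ha hmono, fun k hk => ⟨?_, ?_⟩, fun h => ⟨?_, ?_⟩⟩
  · refine le_trans (ENNReal.ofReal_le_ofReal ?_)
      (minimaxRisk_ellipse_ge_of_isCriticalIndex ha hmono hσ hk)
    have hk1 : (1 : ℝ) ≤ k := by exact_mod_cast hk.1
    calc twoPointConst / 8 * min (((k : ℝ) + 1) * σ ^ 2) (Metric.diam (ellipse a) ^ 2)
        ≤ twoPointConst / 8 * ((4 * k) * σ ^ 2) := by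
          gcongr
          exact (min_le_left _ _).trans (by gcongr; linarith)
      _ = twoPointConst / 2 * (k * σ ^ 2) := by ring
  · rcases min_choice (((k : ℝ) + 1) * σ ^ 2) (Metric.diam (ellipse a) ^ 2) with h | h <;> rw [h]
    · obtain ⟨-, hkn, hk, -⟩ := hk
      refine (gaussianMinimaxRisk_ellipse_le ha σ (M := ((k : ℝ) + 1) * σ ^ 2) (by positivity)
        (Finset.univ.filter fun i : Fin n => n - k ≤ i) fun i hi => ?_).trans
        (ENNReal.ofReal_le_ofReal ?_)
      · rw [← oneIndexed_succ a i]
        exact (oneIndexed_mono ha hmono (by simp at hi; omega) (by omega)).trans hk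
      · rw [card_filter_sub_le hkn]
        nlinarith [sq_nonneg σ]
    · exact hzero.trans (ENNReal.ofReal_le_ofReal (by linarith))
  · refine le_trans (ENNReal.ofReal_le_ofReal ?_)
      (minimaxRisk_ellipse_ge_of_le ha hσ (l := l) (hl ▸ h))
    rw [hdiam]
    linarith
  · exact hzero.trans (ENNReal.ofReal_le_ofReal (by linarith))
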